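/- All graphs are finite and simple; $\chi(G)$ and $\omega(G)$ denote the chromatic number and the clique number of $G$. An oriented tree is an orientation of a (finite) tree, and the length of a directed path is its number of edges. For a positive integer $n$, a graph $G$ is an $n$-willow if there is an oriented tree $T$ with $V(G)\subseteq V(T)$ such that any two distinct vertices $u,v$ of $G$ are adjacent in $G$ if and only if $T$ has a directed path from $u$ to $v$ or from $v$ to $u$ whose length is not a multiple of $n$. A graph is a willow if it is an $n$-willow for some positive integer $n$. For a set $\mathcal{F}$ of graphs, a graph is $\mathcal{F}$-free if it has no induced subgraph isomorphic to a member of $\mathcal{F}$. A class $\mathcal{G}$ of graphs is hereditary if it is closed under isomorphism and under taking induced subgraphs, and it is $\chi$-bounded if there is a function $f$ such that $\chi(H)\le f(\omega(H))$ for every induced subgraph $H$ of every graph in $\mathcal{G}$. Theorem. Let $\mathcal{F}$ be a finite set of graphs, none of which is a willow, and let $q$ be a positive integer. Then there is a hereditary class $\mathcal{G}$ of $\mathcal{F}$-free graphs that is not $\chi$-bounded, but such that every graph $G\in\mathcal{G}$ with $\omega(G)<q$ satisfies $\chi(G)\le\binom{q+1}{3}$. -/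

import Mathlib

/-- A finite simple graph. -/
structure FinGraph where
  V : Type
  finiteV : Finite V
  graph : SimpleGraph V

namespace FinGraph

/-- `G` is `F`-free: no induced subgraph of `G` is isomorphic to a member of `F`. -/
def IsFree (F : Set FinGraph) (G : FinGraph) : Prop :=
  ∀ H ∈ F, ¬ H.graph.IsIndContained G.graph

/-- A class of graphs is hereditary if it is closed under isomorphism and under taking
induced subgraphs. -/
def IsHereditary (C : Set FinGraph) : Prop :=
  ∀ G ∈ C, ∀ H : FinGraph, H.graph.IsIndContained G.graph → H ∈ C

/-- A class of graphs is `χ`-bounded if for some function `f`, every induced subgraph `H` of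
every graph in the class satisfies `χ(H) ≤ f(ω(H))`. -/
def IsChiBounded (C : Set FinGraph) : Prop :=
  ∃ f : ℕ → ℕ, ∀ G ∈ C, ∀ S : Set G.V,
    (G.graph.induce S).chromaticNumber ≤ (f (G.graph.induce S).cliqueNum : ℕ∞)

end FinGraph

/-- An oriented tree: each edge of the underlying tree carries exactly one of its two directions. -/
structure Digraph.IsOrientedTree {W : Type*} (T : Digraph W) : Prop where
  asymm : ∀ x y, T.Adj x y → ¬ T.Adj y x
  isTree : T.toSimpleGraphInclusive.IsTree

/-- There is a directed path (no repeated vertices) of length `l`, that is with `l` edges,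
from `u` to `v` in `T`. -/
def Digraph.HasDirPath {W : Type*} (T : Digraph W) (l : ℕ) (u v : W) : Prop :=
  ∃ p : Fin (l + 1) → W, Function.Injective p ∧ p 0 = u ∧ p (Fin.last l) = v ∧
    ∀ i : Fin l, T.Adj (p i.castSucc) (p i.succ)

namespace FinGraph

/-- `G` is an `n`-willow: for some finite oriented tree `T` and some inclusion `e` of the vertices
of `G` into those of `T`, two distinct vertices of `G` are adjacent if and only if `T` has a
directed path between them, in one of the two directions, of length not a multiple of `n`. -/
def IsNWillow (n : ℕ) (G : FinGraph) : Prop :=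
  ∃ (W : Type) (_ : Finite W) (T : Digraph W) (e : G.V ↪ W), T.IsOrientedTree ∧
    ∀ u v : G.V, u ≠ v →
      (G.graph.Adj u v ↔
        ∃ l : ℕ, ¬ n ∣ l ∧ (T.HasDirPath l (e u) (e v) ∨ T.HasDirPath l (e v) (e u)))

/-- A willow is an `n`-willow for some positive integer `n`. -/
def IsWillow (G : FinGraph) : Prop :=
  ∃ n : ℕ, 0 < n ∧ G.IsNWillow n

end FinGraph

/-! Fix a prime p ≥ q. Take a graph of large girth that is not k-colourable but has a proper
colouring `c` with k + 1 colours, and orient its edges towards the larger colour. Joining vertices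
linked by a directed path of length not divisible by p gives `walkGraph`. It contains the original
graph, so its chromatic number exceeds k, and k is arbitrary.

Directed paths have at most k + 1 vertices, so boundedly many of them meet too few vertices to
contain a cycle. Hence the path length from u to v is unique (`dirWalk_upStep_unique`), and every
small induced subgraph of `walkGraph` is read off from an oriented tree, so is a p-willow
(`isNWillow_of_isIndContained`). No member of the finite set F can therefore appear.

Path lengths mod p form an additive cocycle δ on the reachability preorder. Vertices of a clique
have distinct distances to its top, so ω ≤ p, which defeats any χ-bounding function. If ω < q, then
each v carries a set of fewer than q ≤ p residues, the intersection of its largest in-sets. When u ≤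
v and the two sizes agree, passing from u to v translates this set by δ(u, v). As its size is
invertible mod p, a set can be normalised by its average; the position of 0 then detects the
translation. Two sizes and one position make at most (q + 1 choose 3) colours
(`IsCocycleGraph.colorable`). -/

section Cocycle

/-! ### Colouring graphs defined by cocycles modulo a prime -/

open Finset

variable {V : Type*} [Preorder V] {p : ℕ} [Fact p.Prime]

/-- The elements of `A` below `v` along a chain with top `v`, recorded by their `δ`-distance to `v`. -/
def IsInSet (δ : V → V → ZMod p) (v : V) (A : Finset (ZMod p)) : Prop :=
  ∃ C : Finset V, IsChain (· ≤ ·) (C : Set V) ∧ v ∈ C ∧ (∀ w ∈ C, w ≤ v) ∧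
    C.image (δ · v) = A

theorem cocycle_self {δ : V → V → ZMod p}
    (hδ : ∀ u v w, u ≤ v → v ≤ w → δ u w = δ u v + δ v w) (v : V) : δ v v = 0 := by
  have := hδ v v v le_rfl le_rfl
  simpa using this

theorem isInSet_singleton {δ : V → V → ZMod p}
    (hδ : ∀ u v w, u ≤ v → v ≤ w → δ u w = δ u v + δ v w) (v : V) : IsInSet δ v {0} :=
  ⟨{v}, by simp, by simp, by simp, by simp [cocycle_self hδ]⟩

theorem IsInSet.zero_mem {δ : V → V → ZMod p}
    (hδ : ∀ u v w, u ≤ v → v ≤ w → δ u w = δ u v + δ v w) {v : V} {A : Finset (ZMod p)}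
    (h : IsInSet δ v A) : 0 ∈ A := by
  obtain ⟨C, -, hv, -, rfl⟩ := h
  exact mem_image.2 ⟨v, hv, cocycle_self hδ v⟩

theorem IsInSet.shift {δ : V → V → ZMod p}
    (hδ : ∀ u v w, u ≤ v → v ≤ w → δ u w = δ u v + δ v w) {u v : V} (huv : u ≤ v)
    {A : Finset (ZMod p)} (h : IsInSet δ u A) :
    IsInSet δ v (insert 0 (A.image (· + δ u v))) := by
  classical
  obtain ⟨C, hC, hu, hle, rfl⟩ := h
  refine ⟨insert v C, ?_, by simp, ?_, ?_⟩
  · rw [coe_insert]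
    exact hC.insert fun w hw _ => Or.inr ((hle w hw).trans huv)
  · intro w hw
    rcases mem_insert.1 hw with rfl | hw
    · exact le_rfl
    · exact (hle w hw).trans huv
  · rw [image_insert, cocycle_self hδ, image_image]
    congr 1
    exact image_congr fun w hw => hδ w u v (hle w hw) huv

/-- The graph in which comparable elements are adjacent when their `δ`-distance is nonzero. -/
def IsCocycleGraph (δ : V → V → ZMod p) (H : SimpleGraph V) : Prop :=
  ∀ u v, H.Adj u v ↔ (u ≤ v ∧ δ u v ≠ 0) ∨ (v ≤ u ∧ δ v u ≠ 0)

/-- Keep one chain element per residue: comparable elements with different distances to `v` have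
nonzero distance to each other, by additivity. -/
theorem IsInSet.exists_isClique {δ : V → V → ZMod p}
    (hδ : ∀ u v w, u ≤ v → v ≤ w → δ u w = δ u v + δ v w) {H : SimpleGraph V}
    (hH : IsCocycleGraph δ H) {v : V} {A : Finset (ZMod p)} (h : IsInSet δ v A) :
    ∃ C : Finset V, H.IsClique (C : Set V) ∧ C.card = A.card := by
  classical
  obtain ⟨C, hC, hu, hle, rfl⟩ := h
  obtain ⟨C', hC', hinj, him⟩ := exists_subset_injOn_image_eq_of_surjOn (f := (δ · v)) (C : Set V)
    (C.image (δ · v)) (by rw [coe_image]; exact Set.surjOn_image _ _)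
  refine ⟨C', ?_, by rw [← him, card_image_of_injOn hinj]⟩
  intro a ha b hb hab
  have ne : δ a v ≠ δ b v := fun e => hab (hinj ha hb e)
  have haC := hC' ha
  have hbC := hC' hb
  rw [hH]
  rcases hC haC hbC hab with hle' | hle'
  · refine Or.inl ⟨hle', fun h0 => ne ?_⟩
    rw [hδ a b v hle' (hle b hbC), h0, zero_add]
  · refine Or.inr ⟨hle', fun h0 => ne ?_⟩
    rw [hδ b a v hle' (hle a haC), h0, zero_add]

/-- Adjacency implies comparability, so a maximal element of a clique lies above all of it.
Distances to that element are pairwise distinct residues. -/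
theorem IsCocycleGraph.card_le_of_isClique {δ : V → V → ZMod p}
    (hδ : ∀ u v w, u ≤ v → v ≤ w → δ u w = δ u v + δ v w) {H : SimpleGraph V}
    (hH : IsCocycleGraph δ H) {C : Finset V} (hC : H.IsClique (C : Set V)) : C.card ≤ p := by
  classical
  rcases C.eq_empty_or_nonempty with rfl | hne
  · simp
  obtain ⟨v, hv, hmax⟩ := C.exists_maximal hne
  have htop : ∀ w ∈ C, w ≤ v := by
    intro w hw
    by_cases hwv : w = v
    · exact hwv.le
    rcases (hH w v).1 (hC hw hv hwv) with h | h
    · exact h.1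
    · exact hmax hw h.1
  have hinj : Set.InjOn (δ · v) (C : Set V) := by
    intro a ha b hb hab
    by_contra hne
    have hab : δ a v = δ b v := hab
    rcases (hH a b).1 (hC ha hb hne) with h | h
    · rw [hδ a b v h.1 (htop b hb)] at hab
      exact h.2 (by simpa using hab)
    · rw [hδ b a v h.1 (htop a ha)] at hab
      exact h.2 (by simpa using hab)
  calc C.card = (C.image (δ · v)).card := (card_image_of_injOn hinj).symm
    _ ≤ Fintype.card (ZMod p) := card_le_univ _
    _ = p := ZMod.card p

/-- The average of a set of residues. -/
noncomputable def avg (I : Finset (ZMod p)) : ZMod p := (∑ x ∈ I, x) / I.card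

/-- The translate of a set of residues with average zero. -/
noncomputable def centred (I : Finset (ZMod p)) : Finset (ZMod p) := I.image (· - avg I)

/-- The number of elements of the centred translate of `I` that precede the image of zero. -/
noncomputable def zeroRank (I : Finset (ZMod p)) : ℕ :=
  ((centred I).filter fun x => x.val < (0 - avg I).val).card

theorem zeroRank_lt {I : Finset (ZMod p)} (h0 : 0 ∈ I) : zeroRank I < I.card := by
  have hc : (centred I).card = I.card := card_image_of_injective _ (sub_left_injective)
  rw [← hc]
  refine card_lt_card ⟨filter_subset _ _, fun h => ?_⟩
  have := h (mem_image.2 ⟨0, h0, rfl⟩ : 0 - avg I ∈ centred I)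
  simp at this

/-- The bound `I.card < p` makes the size invertible mod p, so that averaging commutes with
translation. -/
theorem avg_shift {I : Finset (ZMod p)} (hne : I.Nonempty) (hp : I.card < p) (d : ZMod p) :
    avg (I.image (· + d)) = avg I + d := by
  have hinj : Function.Injective (fun x : ZMod p => x + d) := add_left_injective d
  have hc : (I.card : ZMod p) ≠ 0 := by
    rw [Ne, ZMod.natCast_eq_zero_iff]
    exact fun h => absurd (Nat.le_of_dvd hne.card_pos h) (by omega)
  unfold avg
  rw [card_image_of_injective _ hinj, sum_image hinj.injOn, sum_add_distrib]
  simp only [sum_const, nsmul_eq_mul]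
  field_simp

theorem centred_shift {I : Finset (ZMod p)} (hne : I.Nonempty) (hp : I.card < p) (d : ZMod p) :
    centred (I.image (· + d)) = centred I := by
  unfold centred
  rw [avg_shift hne hp, image_image]
  exact image_congr fun x _ => by simp

/-- Both sets have the same centred translate, in which a member is determined by how many members
precede it. Equal ranks thus force equal averages, while the averages differ by `d`. -/
theorem eq_zero_of_zeroRank_shift_eq {I : Finset (ZMod p)} (hp : I.card < p) (h0 : 0 ∈ I)
    {d : ZMod p} (hd : 0 ∈ I.image (· + d)) (h : zeroRank I = zeroRank (I.image (· + d))) :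
    d = 0 := by
  have key : ∀ (K : Finset (ZMod p)) (a b : ZMod p), a ∈ K →
      (K.filter fun x => x.val < a.val).card = (K.filter fun x => x.val < b.val).card →
      ¬ a.val < b.val := by
    intro K a b ha hcard hlt
    refine absurd hcard (card_lt_card ⟨fun x hx => ?_, fun hsub => ?_⟩).ne
    · rw [mem_filter] at hx ⊢
      exact ⟨hx.1, hx.2.trans hlt⟩
    · have := hsub (mem_filter.2 ⟨ha, hlt⟩)
      simp at this
  have ha : 0 - avg I ∈ centred I := mem_image.2 ⟨0, h0, rfl⟩
  have hb : 0 - avg (I.image (· + d)) ∈ centred I := by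
    rw [← centred_shift ⟨0, h0⟩ hp d]
    exact mem_image.2 ⟨0, hd, rfl⟩
  unfold zeroRank at h
  rw [centred_shift ⟨0, h0⟩ hp d] at h
  have heq := le_antisymm (not_lt.1 (key _ _ _ hb h.symm)) (not_lt.1 (key _ _ _ ha h))
  have := ZMod.val_injective p heq
  rw [avg_shift ⟨0, h0⟩ hp] at this
  simpa using this

open Classical in
/-- The largest size of an in-set at `v`. -/
noncomputable def inSize (δ : V → V → ZMod p) (v : V) : ℕ :=
  ((univ : Finset (Finset (ZMod p))).filter (IsInSet δ v)).sup card

open Classical in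
/-- The intersection of the largest in-sets at `v`. -/
noncomputable def inCore (δ : V → V → ZMod p) (v : V) : Finset (ZMod p) :=
  univ.filter fun x => ∀ A, IsInSet δ v A → A.card = inSize δ v → x ∈ A

theorem IsInSet.card_le_inSize {δ : V → V → ZMod p} {v : V} {A : Finset (ZMod p)}
    (h : IsInSet δ v A) : A.card ≤ inSize δ v := by
  classical
  exact le_sup (f := card) (mem_filter.2 ⟨mem_univ A, h⟩)

theorem exists_isInSet_card_eq {δ : V → V → ZMod p}
    (hδ : ∀ u v w, u ≤ v → v ≤ w → δ u w = δ u v + δ v w) (v : V) :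
    ∃ A, IsInSet δ v A ∧ A.card = inSize δ v := by
  classical
  obtain ⟨A, hA, h⟩ := exists_mem_eq_sup
    ((univ : Finset (Finset (ZMod p))).filter (IsInSet δ v))
    ⟨{0}, mem_filter.2 ⟨mem_univ _, isInSet_singleton hδ v⟩⟩ card
  exact ⟨A, (mem_filter.1 hA).2, h.symm⟩

theorem zero_mem_inCore {δ : V → V → ZMod p}
    (hδ : ∀ u v w, u ≤ v → v ≤ w → δ u w = δ u v + δ v w) (v : V) : 0 ∈ inCore δ v := by
  simp only [inCore, mem_filter, mem_univ, true_and]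
  exact fun A hA _ => hA.zero_mem hδ

theorem card_inCore_le {δ : V → V → ZMod p}
    (hδ : ∀ u v w, u ≤ v → v ≤ w → δ u w = δ u v + δ v w) (v : V) :
    (inCore δ v).card ≤ inSize δ v := by
  obtain ⟨A, hA, h⟩ := exists_isInSet_card_eq hδ v
  rw [← h]
  refine card_le_card fun x hx => ?_
  simp only [inCore, mem_filter, mem_univ, true_and] at hx
  exact hx A hA h

/-- A largest in-set at `u`, shifted by `δ u v`, is after inserting 0 an in-set at `v`. Since the
maximal sizes agree, it is again largest and 0 was already present, so it contains the core at `v`.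
-/
theorem inCore_subset_shift {δ : V → V → ZMod p}
    (hδ : ∀ u v w, u ≤ v → v ≤ w → δ u w = δ u v + δ v w) {u v : V} (huv : u ≤ v)
    (hi : inSize δ u = inSize δ v) : inCore δ v ⊆ (inCore δ u).image (· + δ u v) := by
  intro x hx
  simp only [inCore, mem_filter, mem_univ, true_and] at hx
  refine mem_image.2 ⟨x - δ u v, ?_, by simp⟩
  simp only [inCore, mem_filter, mem_univ, true_and]
  intro A hA hc
  have hs := hA.shift hδ huv
  have hcard : (A.image (· + δ u v)).card = A.card :=
    card_image_of_injective _ (add_left_injective _)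
  have hsub : A.image (· + δ u v) = insert 0 (A.image (· + δ u v)) :=
    eq_of_subset_of_card_le (subset_insert _ _) (by
      have := hs.card_le_inSize
      omega)
  have := hx _ hs (by rw [← hsub]; omega)
  rw [← hsub] at this
  obtain ⟨y, hy, rfl⟩ := mem_image.1 this
  simpa using hy

/-- Triples of naturals `r < s ≤ i < q`, as a sigma finset. -/
def colourTriples (q : ℕ) : Finset (Σ _ : ℕ, Σ _ : ℕ, ℕ) :=
  (range q).sigma fun i => (range (i + 1)).sigma fun s => range s

/-- Replacing i by i + 1 turns the triples into r < s < i + 1 < q + 1, the 3-subsets of a (q +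
1)-set. -/
theorem card_colourTriples (q : ℕ) : (colourTriples q).card = (q + 1).choose 3 := by
  simp only [colourTriples, card_sigma, card_range]
  induction q with
  | zero => rfl
  | succ n ih =>
    rw [sum_range_succ, ih, Nat.choose_succ_succ' (n + 1) 2, add_comm, sum_range_id,
      Nat.choose_two_right]

theorem IsCocycleGraph.colorable {δ : V → V → ZMod p}
    (hδ : ∀ u v w, u ≤ v → v ≤ w → δ u w = δ u v + δ v w) {H : SimpleGraph V}
    (hH : IsCocycleGraph δ H) {q : ℕ} (hqp : q ≤ p)
    (hq : ∀ C : Finset V, H.IsClique (C : Set V) → C.card < q) :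
    H.Colorable ((q + 1).choose 3) := by
  have hsize : ∀ v, inSize δ v < q := by
    intro v
    obtain ⟨A, hA, h⟩ := exists_isInSet_card_eq hδ v
    obtain ⟨C, hC, hc⟩ := hA.exists_isClique hδ hH
    rw [← h, ← hc]
    exact hq C hC
  let col : V → colourTriples q := fun v =>
    ⟨⟨inSize δ v, (inCore δ v).card, zeroRank (inCore δ v)⟩, by
      simp only [colourTriples, mem_sigma, mem_range]
      exact ⟨hsize v, Nat.lt_succ_of_le (card_inCore_le hδ v), zeroRank_lt (zero_mem_inCore hδ v)⟩⟩
  have key : ∀ u v, u ≤ v → δ u v ≠ 0 → col u ≠ col v := by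
    intro u v huv hne heq
    have h := Subtype.ext_iff.1 heq
    simp only [col, Sigma.mk.injEq, heq_eq_eq] at h
    obtain ⟨h1, h2, h3⟩ := h
    have hcard : ((inCore δ u).image (· + δ u v)).card = (inCore δ u).card :=
      card_image_of_injective _ (add_left_injective _)
    -- Equal core sizes upgrade the inclusion to equality, so the two cores are translates and the
    -- third colour coordinate can compare the positions of 0.
    have hcore : inCore δ v = (inCore δ u).image (· + δ u v) :=
      eq_of_subset_of_card_le (inCore_subset_shift hδ huv h1) (by omega)
    refine hne (eq_zero_of_zeroRank_shift_eq (I := inCore δ u) ?_ (zero_mem_inCore hδ u) ?_ ?_)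
    · have := card_inCore_le hδ u
      have := hsize u
      omega
    · rw [← hcore]; exact zero_mem_inCore hδ v
    · rw [← hcore]; exact h3
  let c : H.Coloring (colourTriples q) := SimpleGraph.Coloring.mk col (by
    intro u v huv
    rcases (hH u v).1 huv with h | h
    · exact key u v h.1 h.2
    · exact (key v u h.1 h.2).symm)
  have := c.colorable
  rwa [Fintype.card_coe, card_colourTriples] at this

end Cocycle

/-! ### Counting random sequences of edges -/

section RandomEdges

open Finset

variable {ι α : Type*} [Fintype ι] [DecidableEq ι] [Fintype α] [DecidableEq α]

theorem card_filter_forall_mem (J : Finset ι) (B : Finset α) :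
    (univ.filter fun f : ι → α => ∀ i ∈ J, f i ∈ B).card =
      B.card ^ J.card * Fintype.card α ^ (Fintype.card ι - J.card) := by
  have : (univ.filter fun f : ι → α => ∀ i ∈ J, f i ∈ B) =
      Fintype.piFinset fun i => if i ∈ J then B else univ := by
    ext f
    simp only [mem_filter, mem_univ, true_and, Fintype.mem_piFinset]
    refine forall_congr' fun i => ?_
    by_cases h : i ∈ J <;> simp [h]
  rw [this, Fintype.card_piFinset]
  simp_rw [apply_ite card]
  rw [prod_ite, prod_const, prod_const, filter_not, card_sdiff, inter_univ]
  simp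

/-- The finsets of size `s` spanning no pair `f i`. -/
def IsSpanFree (f : ι → α × α) (A : Finset α) : Prop := ∀ i, f i ∉ A.offDiag

/-- The pairs of a vertex set and an index set, of equal size between one and `M`, such that the
vertex set spans all indexed pairs. -/
def densePairs (f : ι → α × α) (M : ℕ) : Finset (Finset α × Finset ι) :=
  ((Icc 1 M).biUnion fun t => powersetCard t univ ×ˢ powersetCard t univ).filter
    fun P => ∀ i ∈ P.2, f i ∈ P.1 ×ˢ P.1

theorem mem_densePairs {f : ι → α × α} {M : ℕ} {Y : Finset α} {J : Finset ι} :
    (Y, J) ∈ densePairs f M ↔ (1 ≤ Y.card ∧ Y.card ≤ M) ∧ J.card = Y.card ∧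
      ∀ i ∈ J, f i ∈ Y ×ˢ Y := by
  simp only [densePairs, mem_filter, mem_biUnion, mem_Icc, mem_product, mem_powersetCard_univ]
  constructor
  · rintro ⟨⟨t, ht, rfl, hJ⟩, h⟩
    exact ⟨ht, hJ, h⟩
  · rintro ⟨ht, hJ, h⟩
    exact ⟨⟨_, ht, rfl, hJ⟩, h⟩

/-- First moment: with n points and Cn random pairs, size t contributes on average at most n^t
(Cn)^t (t²/n²)^t = (Ct²)^t, which does not depend on n. -/
theorem sum_card_densePairs_le {C : ℕ} (hι : Fintype.card ι = C * Fintype.card α) (M : ℕ) :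
    ∑ f : ι → α × α, (densePairs f M).card ≤
      (∑ t ∈ Icc 1 M, (C * t ^ 2) ^ t) * Fintype.card (ι → α × α) := by
  set n := Fintype.card α with hn
  set m := Fintype.card ι with hm
  have hpair : ∀ t ∈ Icc 1 M, ∀ P ∈ (powersetCard t univ ×ˢ powersetCard t univ :
      Finset (Finset α × Finset ι)),
      (univ.filter fun f : ι → α × α => ∀ i ∈ P.2, f i ∈ P.1 ×ˢ P.1).card =
        (t * t) ^ t * (n * n) ^ (m - t) := by
    intro t _ P hP
    rw [mem_product, mem_powersetCard_univ, mem_powersetCard_univ] at hP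
    rw [card_filter_forall_mem, card_product, hP.1, hP.2, Fintype.card_prod]
  calc ∑ f : ι → α × α, (densePairs f M).card
      = ∑ P ∈ (Icc 1 M).biUnion fun t => (powersetCard t univ ×ˢ powersetCard t univ :
          Finset (Finset α × Finset ι)),
          (univ.filter fun f : ι → α × α => ∀ i ∈ P.2, f i ∈ P.1 ×ˢ P.1).card := by
        simp only [densePairs, card_filter]
        exact sum_comm
    _ ≤ ∑ t ∈ Icc 1 M, ∑ P ∈ (powersetCard t univ ×ˢ powersetCard t univ :
          Finset (Finset α × Finset ι)),
          (univ.filter fun f : ι → α × α => ∀ i ∈ P.2, f i ∈ P.1 ×ˢ P.1).card := by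
        rw [sum_biUnion]
        intro a _ b _ hab
        refine disjoint_left.2 fun P ha hb => hab ?_
        simp only [mem_product, mem_powersetCard_univ] at ha hb
        exact ha.1.symm.trans hb.1
    _ ≤ ∑ t ∈ Icc 1 M, (C * t ^ 2) ^ t * Fintype.card (ι → α × α) := by
        refine sum_le_sum fun t ht => ?_
        rw [sum_congr rfl (hpair t ht), sum_const, card_product, card_powersetCard,
          card_powersetCard, card_univ, card_univ, smul_eq_mul, ← hn, ← hm, Fintype.card_fun,
          Fintype.card_prod, ← hn, ← hm]
        -- For t > m there are no index sets; otherwise the truncated m - t is a true difference.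
        rcases lt_or_ge m t with hmt | hmt
        · simp [Nat.choose_eq_zero_of_lt hmt]
        calc n.choose t * m.choose t * ((t * t) ^ t * (n * n) ^ (m - t))
            ≤ n ^ t * (C * n) ^ t * ((t * t) ^ t * (n * n) ^ (m - t)) := by
              rw [← hι]
              gcongr <;> exact Nat.choose_le_pow _ _
          _ = (C * t ^ 2) ^ t * ((n * n) ^ t * (n * n) ^ (m - t)) := by
              simp only [mul_pow, pow_two]; ring
          _ = (C * t ^ 2) ^ t * (n * n) ^ m := by
              rw [← pow_add, Nat.add_sub_cancel' hmt]
    _ = _ := by rw [sum_mul]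

open Classical in
theorem card_exists_isSpanFree_le (s : ℕ) :
    (univ.filter fun f : ι → α × α => ∃ A : Finset α, A.card = s ∧ IsSpanFree f A).card ≤
      2 ^ Fintype.card α *
        (Fintype.card α * Fintype.card α - (s * s - s)) ^ Fintype.card ι := by
  calc _ ≤ ((powersetCard s (univ : Finset α)).biUnion fun A =>
        univ.filter fun f : ι → α × α => ∀ i ∈ univ, f i ∈ A.offDiagᶜ).card := by
        refine card_le_card fun f hf => ?_
        simp only [mem_filter, mem_univ, true_and] at hf
        obtain ⟨A, hA, h⟩ := hf
        simp only [mem_biUnion, mem_powersetCard_univ, mem_filter, mem_univ, true_and]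
        exact ⟨A, hA, fun i _ => mem_compl.2 (h i)⟩
    _ ≤ (powersetCard s (univ : Finset α)).card *
        (Fintype.card α * Fintype.card α - (s * s - s)) ^ Fintype.card ι := by
        refine card_biUnion_le_card_mul _ _ _ fun A hA => ?_
        rw [mem_powersetCard_univ] at hA
        rw [card_filter_forall_mem, card_compl, offDiag_card, hA, Fintype.card_prod, card_univ]
        simp
    _ ≤ _ := by
        gcongr
        rw [← card_univ, ← card_powerset]
        exact card_le_card fun A _ => by simp

/-- For s ≥ 2, s² - s ≥ s²/2, so a random pair falls in the off-diagonal of an s-set with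
probability at least 1/(8k²). -/
theorem mul_sub_offDiag_le {k s n a : ℕ} (hs : 2 ≤ s) (hn : n = 2 * k * s)
    (ha : 8 * k ^ 2 = a + 1) : (a + 1) * (n * n - (s * s - s)) ≤ a * (n * n) := by
  have h2 : n * n ≤ (a + 1) * (s * s - s) := by
    obtain ⟨r, rfl⟩ : ∃ r, s = r + 2 := ⟨s - 2, by omega⟩
    have h3 : (r + 2) * (r + 2) - (r + 2) = (r + 2) * (r + 1) := by
      rw [Nat.sub_eq_iff_eq_add (by nlinarith)]; ring
    rw [h3, ← ha, hn]
    have h4 : (r + 2) * (r + 2) ≤ 2 * ((r + 2) * (r + 1)) := by nlinarith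
    calc 2 * k * (r + 2) * (2 * k * (r + 2)) = 4 * k ^ 2 * ((r + 2) * (r + 2)) := by ring
      _ ≤ 4 * k ^ 2 * (2 * ((r + 2) * (r + 1))) := Nat.mul_le_mul_left _ h4
      _ = 8 * k ^ 2 * ((r + 2) * (r + 1)) := by ring
  rw [Nat.mul_sub, Nat.sub_le_iff_le_add, add_mul, one_mul]
  exact Nat.add_le_add_left h2 _

-- Union bound: at most 2^n sets, each avoided with probability at most (1 - 1/(8k²))^(Cn) ≤ 4^(-n)
-- by the choice of C. The resulting 2^(-n) is at most 1/4.
open Classical in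
theorem four_mul_card_exists_isSpanFree_le {k s C : ℕ} (hk : 0 < k) (hs : 2 ≤ s)
    (hC : 4 * (8 * k ^ 2 - 1) ^ C ≤ (8 * k ^ 2) ^ C) (hα : Fintype.card α = 2 * k * s)
    (hι : Fintype.card ι = C * Fintype.card α) :
    4 * (univ.filter fun f : ι → α × α => ∃ A : Finset α, A.card = s ∧ IsSpanFree f A).card ≤
      Fintype.card (ι → α × α) := by
  have hbadle := card_exists_isSpanFree_le (ι := ι) (α := α) s
  generalize (univ.filter fun f : ι → α × α =>
    ∃ A : Finset α, A.card = s ∧ IsSpanFree f A).card = bad at hbadle ⊢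
  rw [Fintype.card_fun, Fintype.card_prod]
  generalize Fintype.card α = n at *
  generalize Fintype.card ι = m at *
  have hn2 : 2 ≤ n := by
    have : 1 * 2 ≤ k * s := Nat.mul_le_mul hk hs
    rw [hα, mul_assoc]
    omega
  obtain ⟨a, ha⟩ : ∃ a, 8 * k ^ 2 = a + 1 :=
    ⟨8 * k ^ 2 - 1, by have : 0 < k ^ 2 := by positivity
                       omega⟩
  have hpow : 4 ^ n * a ^ m ≤ (a + 1) ^ m := by
    rw [ha, Nat.add_sub_cancel] at hC
    calc 4 ^ n * a ^ m = (4 * a ^ C) ^ n := by rw [hι, mul_pow, ← pow_mul]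
      _ ≤ ((a + 1) ^ C) ^ n := Nat.pow_le_pow_left hC n
      _ = (a + 1) ^ m := by rw [hι, ← pow_mul]
  have hbad2 : bad * 2 ^ n ≤ (n * n) ^ m := by
    refine Nat.le_of_mul_le_mul_left (?_ : (a + 1) ^ m * _ ≤ (a + 1) ^ m * _) (by positivity)
    calc (a + 1) ^ m * (bad * 2 ^ n)
        ≤ (a + 1) ^ m * (2 ^ n * (n * n - (s * s - s)) ^ m * 2 ^ n) :=
          Nat.mul_le_mul_left _ (Nat.mul_le_mul_right _ hbadle)
      _ = 4 ^ n * ((a + 1) * (n * n - (s * s - s))) ^ m := by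
          rw [mul_pow, show (4 : ℕ) = 2 * 2 by norm_num, mul_pow]; ring
      _ ≤ 4 ^ n * (a * (n * n)) ^ m :=
          Nat.mul_le_mul_left _ (Nat.pow_le_pow_left (mul_sub_offDiag_le hs hα ha) m)
      _ = 4 ^ n * a ^ m * (n * n) ^ m := by rw [mul_pow, mul_assoc]
      _ ≤ (a + 1) ^ m * (n * n) ^ m := Nat.mul_le_mul_right _ hpow
  have h4 : 2 ^ 2 ≤ 2 ^ n := Nat.pow_le_pow_right (by norm_num) hn2
  calc 4 * bad = bad * 2 ^ 2 := by ring
    _ ≤ bad * 2 ^ n := Nat.mul_le_mul_left _ h4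
    _ ≤ _ := hbad2

/-- At least three quarters of all `f` have no span-free s-set. If each of these had more than twice
the mean bound of dense pairs, the total would exceed the first moment. -/
theorem exists_few_densePairs {k s C M : ℕ} (hk : 0 < k) (hs : 2 ≤ s)
    (hC : 4 * (8 * k ^ 2 - 1) ^ C ≤ (8 * k ^ 2) ^ C) (hα : Fintype.card α = 2 * k * s)
    (hι : Fintype.card ι = C * Fintype.card α) :
    ∃ f : ι → α × α, (∀ A : Finset α, A.card = s → ¬ IsSpanFree f A) ∧
      (densePairs f M).card ≤ 2 * ∑ t ∈ Icc 1 M, (C * t ^ 2) ^ t := by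
  classical
  have hbad4 := four_mul_card_exists_isSpanFree_le hk hs hC hα hι
  have hsum := sum_card_densePairs_le (α := α) hι M
  have hT : 0 < Fintype.card (ι → α × α) := by
    have : Nonempty α := Fintype.card_pos_iff.1 (by rw [hα]; positivity)
    exact Fintype.card_pos
  generalize ∑ t ∈ Icc 1 M, (C * t ^ 2) ^ t = K at hsum ⊢
  by_contra! hcon
  generalize hbad : (univ.filter fun f : ι → α × α =>
    ∃ A : Finset α, A.card = s ∧ IsSpanFree f A) = bad at hbad4
  have hlow : ∀ f ∈ badᶜ, 2 * K + 1 ≤ (densePairs f M).card := by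
    intro f hf
    refine hcon f fun A hA hfree => ?_
    rw [← hbad] at hf
    exact mem_compl.1 hf (mem_filter.2 ⟨mem_univ _, A, hA, hfree⟩)
  have h1 : badᶜ.card * (2 * K + 1) ≤ K * Fintype.card (ι → α × α) :=
    calc badᶜ.card * (2 * K + 1) ≤ ∑ f ∈ badᶜ, (densePairs f M).card := by
          rw [← smul_eq_mul]; exact card_nsmul_le_sum _ _ _ hlow
      _ ≤ ∑ f, (densePairs f M).card := sum_le_sum_of_subset (subset_univ _)
      _ ≤ _ := hsum
  have h2 : bad.card + badᶜ.card = Fintype.card (ι → α × α) := card_add_card_compl bad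
  generalize Fintype.card (ι → α × α) = T at *
  generalize badᶜ.card = x at *
  have h3 : 3 * T ≤ 4 * x := by omega
  have h4 := Nat.mul_le_mul_right (2 * K + 1) h3
  nlinarith

end RandomEdges

/-! ### Large girth and large chromatic number -/

namespace SimpleGraph

/-- The graph whose edges are the values of `f`. -/
def edgeGraph {ι α : Type*} (f : ι → α × α) : SimpleGraph α :=
  fromRel fun a b => ∃ i, f i = (a, b)

-- A cycle has as many edges as vertices; choosing an index for each edge gives the dense pair.
open Finset in
theorem exists_densePair_of_isCycle {ι α : Type*} [Fintype ι] [DecidableEq ι] [Fintype α]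
    [DecidableEq α] {f : ι → α × α} {M : ℕ} {v : α} {w : (edgeGraph f).Walk v v}
    (hw : w.IsCycle) (hM : w.length ≤ M) :
    ∃ J, (w.support.tail.toFinset, J) ∈ densePairs f M := by
  have hidx : ∀ e ∈ w.edges, ∃ i, s((f i).1, (f i).2) = e := by
    intro e he
    have := w.edges_subset_edgeSet he
    induction e with
    | _ a b =>
      rw [mem_edgeSet, edgeGraph, fromRel_adj] at this
      obtain ⟨-, ⟨i, hi⟩ | ⟨i, hi⟩⟩ := this
      · exact ⟨i, by rw [hi]⟩
      · exact ⟨i, by rw [hi]; exact Sym2.eq_swap⟩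
  have : Nonempty ι := by
    obtain ⟨e, he⟩ := List.exists_mem_of_ne_nil _ (mt Walk.edges_eq_nil.1 hw.not_nil)
    exact ⟨(hidx e he).choose⟩
  choose! g hg using hidx
  have hY : w.support.tail.toFinset.card = w.length := by
    rw [List.toFinset_card_of_nodup hw.support_nodup, List.length_tail, Walk.length_support]
    rfl
  refine ⟨w.edges.toFinset.image g, mem_densePairs.2 ⟨⟨?_, hY.trans_le hM⟩, ?_, ?_⟩⟩
  · rw [hY]; have := hw.three_le_length; omega
  · rw [hY, card_image_of_injOn, List.toFinset_card_of_nodup hw.edges_nodup, Walk.length_edges]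
    intro a ha b hb hab
    rw [← hg a (by simpa using ha), ← hg b (by simpa using hb), hab]
  · intro i hi
    obtain ⟨e, he, rfl⟩ := mem_image.1 hi
    rw [List.mem_toFinset] at he
    have hmem : ∀ x ∈ e, x ∈ w.support.tail.toFinset := by
      intro x hx
      have hxs := w.mem_support_of_mem_edges he hx
      rw [List.mem_toFinset]
      rw [← Walk.cons_tail_support, List.mem_cons] at hxs
      rcases hxs with rfl | h
      · exact Walk.end_mem_tail_support hw.not_nil
      · exact h
    have hends : ∀ x ∈ s((f (g e)).1, (f (g e)).2), x ∈ w.support.tail.toFinset := by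
      rwa [hg e he]
    exact mem_product.2 ⟨hends _ (Sym2.mem_mk_left _ _), hends _ (Sym2.mem_mk_right _ _)⟩

-- Erdős's deletion method: removing a vertex from every dense pair destroys the short cycles and
-- costs at most half of the 2ks vertices. A k-colouring of the rest would have a class of size s,
-- which must span an edge.
open Finset in
theorem exists_not_colorable_le_egirth {k : ℕ} (hk : 0 < k) (M : ℕ) :
    ∃ (V : Type) (_ : Finite V) (G : SimpleGraph V), ¬ G.Colorable k ∧ (M : ℕ∞) ≤ G.egirth := by
  classical
  obtain ⟨C, hC⟩ : ∃ C, 4 * (8 * k ^ 2 - 1) ^ C ≤ (8 * k ^ 2) ^ C := by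
    have hkk : 0 < k ^ 2 := by positivity
    obtain ⟨a, ha⟩ : ∃ a, 8 * k ^ 2 = a + 1 := ⟨8 * k ^ 2 - 1, by omega⟩
    rw [ha, Nat.add_sub_cancel]
    obtain ⟨C, hC⟩ := exists_pow_lt_of_lt_one (show (0 : ℝ) < 1 / 4 by norm_num)
      (show (a : ℝ) / (a + 1) < 1 by rw [div_lt_one (by positivity)]; linarith)
    refine ⟨C, ?_⟩
    rw [div_pow, div_lt_iff₀ (by positivity)] at hC
    have : (4 * a ^ C : ℝ) ≤ (a + 1) ^ C := by linarith
    exact_mod_cast this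
  set K := ∑ t ∈ Icc 1 M, (C * t ^ 2) ^ t with hK
  -- Large enough that the at most 2K deleted vertices number at most ks, and that s ≥ 2.
  set s := 2 * K + 2 with hs
  obtain ⟨f, hf, hdense⟩ := exists_few_densePairs (α := Fin (2 * k * s))
    (ι := Fin (C * (2 * k * s))) (s := s) (M := M) hk (by omega) hC (by simp) (by simp)
  have hpick : ∀ P ∈ densePairs f M, ∃ x, x ∈ P.1 := by
    rintro ⟨Y, J⟩ h
    exact card_pos.1 (mem_densePairs.1 h).1.1
  have : Nonempty (Fin (2 * k * s)) := ⟨⟨0, by positivity⟩⟩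
  choose! z hz using hpick
  let Z := (densePairs f M).image z
  have hZ : Z.card ≤ k * s :=
    (card_image_le.trans hdense).trans (by rw [hs]; nlinarith)
  let G := (edgeGraph f).induce ((Z : Set (Fin (2 * k * s)))ᶜ)
  refine ⟨_, inferInstance, G, ?_, ?_⟩
  · rintro ⟨c⟩
    have : Nonempty (Fin k) := ⟨⟨0, hk⟩⟩
    obtain ⟨y, -, hy⟩ := exists_le_card_fiber_of_mul_le_card_of_maps_to (s := (univ : Finset
      ((Z : Set (Fin (2 * k * s)))ᶜ : Set _))) (t := univ) (f := c) (n := s) (by simp)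
      univ_nonempty (by
        rw [card_univ, card_univ, Fintype.card_fin, Fintype.card_compl_set, Fintype.card_fin]
        simp only [coe_sort_coe, Fintype.card_coe]
        have : 2 * k * s = k * s + k * s := by ring
        omega)
    obtain ⟨A, hA, hcard⟩ := exists_subset_card_eq hy
    refine hf (A.map (Function.Embedding.subtype _)) (by rw [card_map, hcard]) ?_
    intro i hi
    rw [mem_offDiag, mem_map, mem_map] at hi
    obtain ⟨⟨a, ha, ha'⟩, ⟨b, hb, hb'⟩, hne⟩ := hi
    have hadj : G.Adj a b := by
      change (edgeGraph f).Adj a b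
      rw [edgeGraph, fromRel_adj]
      refine ⟨?_, Or.inl ⟨i, ?_⟩⟩
      · intro h; exact hne (ha'.symm.trans (h.trans hb'))
      · exact Prod.ext ha'.symm hb'.symm
    refine c.valid hadj ?_
    rw [(mem_filter.1 (hA ha)).2, (mem_filter.1 (hA hb)).2]
  · refine le_egirth.2 fun v w hw => ?_
    by_contra! hlt
    have hlt : w.length < M := by exact_mod_cast hlt
    have hinj : Function.Injective (Embedding.induce (G := edgeGraph f)
      ((Z : Set (Fin (2 * k * s)))ᶜ)).toHom :=
      (Embedding.induce (G := edgeGraph f) _).injective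
    obtain ⟨J, hJ⟩ := exists_densePair_of_isCycle (hw.map hinj) (M := M) (by
      rw [Walk.length_map]; exact hlt.le)
    have hsupp := List.mem_of_mem_tail (List.mem_toFinset.1 (hz _ hJ))
    have hmem : z _ ∈ Z := mem_image_of_mem z hJ
    generalize z _ = y at hsupp hmem
    rw [Walk.support_map, List.mem_map] at hsupp
    obtain ⟨x, -, rfl⟩ := hsupp
    exact x.2 hmem

/-- Adding one vertex raises the chromatic number by at most one, so k + 1 is attained. This fixes
the number of colours, hence the length of increasing paths, before the girth is chosen. -/
theorem exists_induce_colorable_succ {V : Type*} [Finite V] {G : SimpleGraph V} {k : ℕ}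
    (h : ¬ G.Colorable k) :
    ∃ U : Set V, ¬ (G.induce U).Colorable k ∧ (G.induce U).Colorable (k + 1) := by
  classical
  cases nonempty_fintype V
  by_contra! hcon
  refine h ?_
  suffices ∀ U : Finset V, (G.induce (U : Set V)).Colorable k by
    have h1 := this Finset.univ
    rw [Finset.coe_univ] at h1
    exact h1.of_hom (induceUnivIso G).symm.toHom
  intro U
  induction U using Finset.induction_on with
  | empty =>
    rw [Finset.coe_empty]
    exact .of_isEmpty _
  | insert a U ha ih =>
    by_contra hn
    refine hcon _ hn ?_
    obtain ⟨c⟩ := ih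
    refine ⟨Coloring.mk (fun x => if hx : x.1 ∈ U then (c ⟨x.1, hx⟩).castSucc else Fin.last k) ?_⟩
    rintro ⟨x, hx⟩ ⟨y, hy⟩ hxy
    have hxy : G.Adj x y := hxy
    by_cases hxU : x ∈ U <;> by_cases hyU : y ∈ U
    · simp only [hxU, hyU, dif_pos, ne_eq, Fin.castSucc_inj]
      exact c.valid (v := ⟨x, hxU⟩) (w := ⟨y, hyU⟩) hxy
    · simp only [hxU, hyU, dif_pos, dif_neg, not_false_eq_true]
      exact (Fin.castSucc_lt_last _).ne
    · simp only [hxU, hyU, dif_pos, dif_neg, not_false_eq_true]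
      exact (Fin.castSucc_lt_last _).ne'
    · have h1 : x = a := by simpa [hxU] using hx
      have h2 : y = a := by simpa [hyU] using hy
      exact absurd (h1.trans h2.symm) hxy.ne

theorem egirth_le_egirth_induce {V : Type*} (G : SimpleGraph V) (U : Set V) :
    G.egirth ≤ (G.induce U).egirth := by
  refine le_egirth.2 fun v w hw => ?_
  have hinj : Function.Injective (Embedding.induce (G := G) U).toHom :=
    (Embedding.induce (G := G) U).injective
  have := le_egirth.1 (le_refl G.egirth) _ _ (hw.map hinj)
  rwa [Walk.length_map] at this

/-- There are graphs of large girth with chromatic number exactly `k + 1`. -/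
theorem exists_colouring_of_large_girth {k : ℕ} (hk : 0 < k) (M : ℕ) :
    ∃ (V : Type) (_ : Finite V) (G : SimpleGraph V) (c : V → ℕ), ¬ G.Colorable k ∧
      (M : ℕ∞) ≤ G.egirth ∧ (∀ u v, G.Adj u v → c u ≠ c v) ∧ ∀ v, c v < k + 1 := by
  obtain ⟨V, hV, G, hG, hM⟩ := exists_not_colorable_le_egirth hk M
  obtain ⟨U, hU, ⟨c⟩⟩ := exists_induce_colorable_succ hG
  exact ⟨U, inferInstance, G.induce U, fun v => c v, hU,
    hM.trans (egirth_le_egirth_induce G U), fun u v h e => c.valid h (Fin.ext e), fun v => (c v).2⟩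

end SimpleGraph

/-! ### Directed walks and monotone colourings -/

section DirWalk

variable {V : Type*}

/-- There is a walk of length `l` from `u` to `v` all of whose steps satisfy `r`. -/
inductive DirWalk (r : V → V → Prop) : ℕ → V → V → Prop
  | nil (u : V) : DirWalk r 0 u u
  | cons {l : ℕ} {u v w : V} (h : r u v) (t : DirWalk r l v w) : DirWalk r (l + 1) u w

namespace DirWalk

variable {r s : V → V → Prop} {l m : ℕ} {u v w : V}

theorem mono (h : ∀ a b, r a b → s a b) (hw : DirWalk r l u v) : DirWalk s l u v := by
  induction hw with
  | nil u => exact nil u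
  | cons hr _ ih => exact cons (h _ _ hr) ih

theorem append (h₁ : DirWalk r l u v) (h₂ : DirWalk r m v w) : DirWalk r (l + m) u w := by
  induction h₁ with
  | nil u => simpa using h₂
  | cons hr _ ih =>
    rw [Nat.add_right_comm]
    exact cons hr (ih h₂)

theorem add_le {c : V → ℕ} (hc : ∀ a b, r a b → c a < c b) (hw : DirWalk r l u v) :
    c u + l ≤ c v := by
  induction hw with
  | nil u => simp
  | cons hr _ ih => have := hc _ _ hr; omega

theorem exists_finset [DecidableEq V] (hw : DirWalk r l u v) :
    ∃ X : Finset V, X.card ≤ l + 1 ∧ u ∈ X ∧ DirWalk (fun a b => r a b ∧ a ∈ X ∧ b ∈ X) l u v := by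
  induction hw with
  | nil u => exact ⟨{u}, by simp, by simp, nil u⟩
  | @cons l u v w hr _ ih =>
    obtain ⟨X, hX, hv, hw⟩ := ih
    refine ⟨insert u X, (Finset.card_insert_le _ _).trans (by omega), by simp, ?_⟩
    exact cons ⟨hr, by simp, by simp [hv]⟩ (hw.mono fun a b h =>
      ⟨h.1, Finset.mem_insert_of_mem h.2.1, Finset.mem_insert_of_mem h.2.2⟩)

theorem exists_isPath {G : SimpleGraph V} {c : V → ℕ}
    (hr : ∀ a b, r a b → G.Adj a b ∧ c a < c b) (hw : DirWalk r l u v) :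
    ∃ p : G.Walk u v, p.IsPath ∧ p.length = l ∧ ∀ x ∈ p.support, c u ≤ c x := by
  induction hw with
  | nil u => exact ⟨.nil, .nil, rfl, by simp⟩
  | cons h _ ih =>
    obtain ⟨p, hp, hl, hs⟩ := ih
    obtain ⟨hadj, hlt⟩ := hr _ _ h
    refine ⟨.cons hadj p, ?_, by simp [hl], ?_⟩
    · rw [SimpleGraph.Walk.cons_isPath_iff]
      exact ⟨hp, fun hmem => absurd (hs _ hmem) (by omega)⟩
    · intro x hx
      rw [SimpleGraph.Walk.support_cons, List.mem_cons] at hx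
      rcases hx with rfl | hx
      · exact le_rfl
      · exact hlt.le.trans (hs x hx)

theorem exists_injective {c : V → ℕ} (hc : ∀ a b, r a b → c a < c b) (hw : DirWalk r l u v) :
    ∃ p : Fin (l + 1) → V, Function.Injective p ∧ p 0 = u ∧ p (Fin.last l) = v ∧
      ∀ i : Fin l, r (p i.castSucc) (p i.succ) := by
  suffices ∃ p : Fin (l + 1) → V, p 0 = u ∧ p (Fin.last l) = v ∧
      ∀ i : Fin l, r (p i.castSucc) (p i.succ) by
    obtain ⟨p, h0, hl, hs⟩ := this
    have hmono : StrictMono (c ∘ p) := Fin.strictMono_iff_lt_succ.2 fun i => hc _ _ (hs i)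
    exact ⟨p, hmono.injective.of_comp, h0, hl, hs⟩
  induction hw with
  | nil u => exact ⟨fun _ => u, rfl, rfl, fun i => i.elim0⟩
  | @cons l u v w h _ ih =>
    obtain ⟨p, h0, hl, hs⟩ := ih
    refine ⟨Fin.cons u p, rfl, ?_, fun i => ?_⟩
    · rw [← Fin.succ_last, Fin.cons_succ, hl]
    · refine Fin.cases ?_ (fun i => ?_) i
      · simpa [h0] using h
      · rw [← Fin.succ_castSucc, Fin.cons_succ, Fin.cons_succ]
        exact hs i

theorem of_fin {p : Fin (l + 1) → V} (hs : ∀ i : Fin l, r (p i.castSucc) (p i.succ)) :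
    DirWalk r l (p 0) (p (Fin.last l)) := by
  induction l with
  | zero => exact nil _
  | succ l ih =>
    refine cons (hs 0) ?_
    exact ih (p := fun i => p i.succ) fun i => hs i.succ

end DirWalk

end DirWalk

/-! ### Path-length graphs, their cocycles and willows -/

namespace SimpleGraph

variable {V : Type*}

/-- The spanning subgraph of `G` whose edges are those with both ends in `X`. -/
def restrictTo (G : SimpleGraph V) (X : Set V) : SimpleGraph V where
  Adj a b := G.Adj a b ∧ a ∈ X ∧ b ∈ X
  symm := ⟨fun _ _ h => ⟨h.1.symm, h.2.2, h.2.1⟩⟩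
  loopless := ⟨fun _ h => G.loopless.irrefl _ h.1⟩

theorem restrictTo_le (G : SimpleGraph V) (X : Set V) : G.restrictTo X ≤ G := fun _ _ h => h.1

theorem mem_of_mem_support_tail {G : SimpleGraph V} {X : Set V} {u v : V}
    (w : (G.restrictTo X).Walk u v) : ∀ x ∈ w.support.tail, x ∈ X := by
  induction w with
  | nil => simp
  | cons h p ih =>
    intro x hx
    rw [Walk.support_cons, List.tail_cons, ← Walk.cons_tail_support, List.mem_cons] at hx
    rcases hx with rfl | hx
    · exact h.2.2
    · exact ih x hx

theorem isAcyclic_restrictTo {G : SimpleGraph V} {M : ℕ} (hM : (M : ℕ∞) ≤ G.egirth)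
    {X : Finset V} (hX : X.card < M) : (G.restrictTo X).IsAcyclic := by
  classical
  intro v w hw
  have h1 := le_egirth.1 hM v (w.mapLe (G.restrictTo_le X)) (hw.mapLe _)
  have h2 : w.support.tail.toFinset.card = w.length := by
    rw [List.toFinset_card_of_nodup hw.support_nodup, List.length_tail, Walk.length_support]
    rfl
  have h3 : w.support.tail.toFinset ⊆ X := fun x hx => by
    simpa using mem_of_mem_support_tail w x (List.mem_toFinset.1 hx)
  have h4 := Finset.card_le_card h3
  rw [Walk.length_mapLe] at h1
  have := Nat.cast_le.1 h1
  omega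

/-- The steps along edges of `G` that increase the colour. -/
def upStep (G : SimpleGraph V) (c : V → ℕ) (a b : V) : Prop := G.Adj a b ∧ c a < c b

/-- The graph joining two vertices when a colour-increasing walk between them has length not
divisible by `p`. -/
def walkGraph (G : SimpleGraph V) (c : V → ℕ) (p : ℕ) : SimpleGraph V where
  Adj u v := u ≠ v ∧ ∃ l, ¬ p ∣ l ∧ (DirWalk (G.upStep c) l u v ∨ DirWalk (G.upStep c) l v u)
  symm := ⟨fun _ _ h => ⟨h.1.symm, h.2.imp fun _ hl => ⟨hl.1, hl.2.symm⟩⟩⟩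
  loopless := ⟨fun _ h => h.1 rfl⟩

variable {G : SimpleGraph V} {c : V → ℕ} {N M p : ℕ}

theorem dirWalk_upStep_lt (hN : ∀ v, c v < N) {l : ℕ} {u v : V}
    (h : DirWalk (G.upStep c) l u v) : l < N := by
  have := h.add_le (c := c) fun _ _ h => h.2
  have := hN v
  omega

/-- Two increasing walks together meet at most 2N < M vertices, where the graph is a forest; there
they are paths with the same ends, hence equal. -/
theorem dirWalk_upStep_unique (hN : ∀ v, c v < N) (hM : (M : ℕ∞) ≤ G.egirth) (hNM : 2 * N < M)
    {l m : ℕ} {u v : V} (h : DirWalk (G.upStep c) l u v) (h' : DirWalk (G.upStep c) m u v) :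
    l = m := by
  classical
  have hl := dirWalk_upStep_lt hN h
  have hm := dirWalk_upStep_lt hN h'
  obtain ⟨X, hX, -, hw⟩ := h.exists_finset
  obtain ⟨Y, hY, -, hw'⟩ := h'.exists_finset
  have hac : (G.restrictTo (X ∪ Y : Finset V)).IsAcyclic := isAcyclic_restrictTo hM
    ((Finset.card_union_le X Y).trans_lt (by omega))
  obtain ⟨P, hP, hPl, -⟩ := hw.exists_isPath (G := G.restrictTo (X ∪ Y : Finset V)) (c := c)
    fun a b h => ⟨⟨h.1.1, by simp [h.2.1], by simp [h.2.2]⟩, h.1.2⟩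
  obtain ⟨Q, hQ, hQl, -⟩ := hw'.exists_isPath (G := G.restrictTo (X ∪ Y : Finset V)) (c := c)
    fun a b h => ⟨⟨h.1.1, by simp [h.2.1], by simp [h.2.2]⟩, h.1.2⟩
  have := congrArg Subtype.val ((hac.subsingleton_path u v).elim ⟨P, hP⟩ ⟨Q, hQ⟩)
  simp only at this
  rw [← hPl, ← hQl, this]

theorem le_walkGraph (hc : ∀ u v, G.Adj u v → c u ≠ c v) (hp : p ≠ 1) :
    G ≤ G.walkGraph c p := by
  intro u v h
  refine ⟨h.ne, 1, by simpa using hp, ?_⟩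
  rcases lt_or_gt_of_ne (hc u v h) with hlt | hlt
  · exact Or.inl (.cons ⟨h, hlt⟩ (.nil v))
  · exact Or.inr (.cons ⟨h.symm, hlt⟩ (.nil u))

open Classical in
/-- The length modulo `p` of a colour-increasing walk from `u` to `v`. -/
noncomputable def walkDist (G : SimpleGraph V) (c : V → ℕ) (p : ℕ) (u v : V) : ZMod p :=
  if h : ∃ l, DirWalk (G.upStep c) l u v then (h.choose : ZMod p) else 0

theorem walkDist_eq (hN : ∀ v, c v < N) (hM : (M : ℕ∞) ≤ G.egirth) (hNM : 2 * N < M)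
    {l : ℕ} {u v : V} (h : DirWalk (G.upStep c) l u v) : G.walkDist c p u v = l := by
  have hex : ∃ l, DirWalk (G.upStep c) l u v := ⟨l, h⟩
  rw [walkDist, dif_pos hex, dirWalk_upStep_unique hN hM hNM hex.choose_spec h]

/-- Reachability by colour-increasing walks. -/
abbrev walkPreorder (G : SimpleGraph V) (c : V → ℕ) : Preorder V where
  le u v := ∃ l, DirWalk (G.upStep c) l u v
  le_refl u := ⟨0, .nil u⟩
  le_trans _ _ _ := fun ⟨_, h⟩ ⟨_, h'⟩ => ⟨_, h.append h'⟩

/-- Reachability, pulled back to an embedded graph, carries a cocycle defining that graph. -/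
theorem exists_cocycle [Fact p.Prime] (hN : ∀ v, c v < N) (hM : (M : ℕ∞) ≤ G.egirth) (hNM : 2 * N < M)
    {W : Type*} {H : SimpleGraph W} (f : H ↪g G.walkGraph c p) :
    ∃ (_ : Preorder W) (δ : W → W → ZMod p),
      (∀ u v w, u ≤ v → v ≤ w → δ u w = δ u v + δ v w) ∧ IsCocycleGraph δ H := by
  let _ := walkPreorder G c
  refine ⟨Preorder.lift f, fun a b => G.walkDist c p (f a) (f b), ?_, ?_⟩
  · rintro u v w ⟨l, hl⟩ ⟨m, hm⟩
    beta_reduce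
    rw [walkDist_eq hN hM hNM hl, walkDist_eq hN hM hNM hm,
      walkDist_eq hN hM hNM (hl.append hm), Nat.cast_add]
  · have hd : ∀ a b l, DirWalk (G.upStep c) l a b → (G.walkDist c p a b ≠ 0 ↔ ¬ p ∣ l) := by
      intro a b l h
      rw [walkDist_eq hN hM hNM h, Ne, ZMod.natCast_eq_zero_iff]
    have hne : ∀ a b l, ¬ p ∣ l → DirWalk (G.upStep c) l a b → a ≠ b := by
      rintro a _ l hl h rfl
      rw [dirWalk_upStep_unique hN hM hNM h (.nil a)] at hl
      exact hl (dvd_zero p)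
    intro u v
    rw [← f.map_adj_iff]
    constructor
    · rintro ⟨-, l, hl, h | h⟩
      · exact Or.inl ⟨⟨l, h⟩, (hd _ _ l h).2 hl⟩
      · exact Or.inr ⟨⟨l, h⟩, (hd _ _ l h).2 hl⟩
    · rintro (⟨⟨l, h⟩, h0⟩ | ⟨⟨l, h⟩, h0⟩)
      · have hl := (hd _ _ l h).1 h0
        exact ⟨hne _ _ l hl h, l, hl, Or.inl h⟩
      · have hl := (hd _ _ l h).1 h0
        exact ⟨(hne _ _ l hl h).symm, l, hl, Or.inr h⟩

/-- A forest on `X` extends, through a source `z` outside `X`, to an oriented tree with the same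
directed paths starting in `X`. -/
theorem exists_orientedTree {X : Set V} (hac : (G.restrictTo X).IsAcyclic)
    {z : V} (hz : z ∉ X) (c : V → ℕ) (hc : ∀ u v, G.Adj u v → c u ≠ c v) :
    ∃ T : Digraph V, T.IsOrientedTree ∧ ∀ l, ∀ u ∈ X, ∀ v,
      T.HasDirPath l u v ↔ DirWalk ((G.restrictTo X).upStep c) l u v := by
  classical
  -- The star at `z` connects everything; a spanning tree of the union can be chosen to contain the
  -- given forest.
  let S : SimpleGraph V := SimpleGraph.fromRel fun a _ => a = z
  let K : SimpleGraph V := G.restrictTo X ⊔ S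
  have hK : K.Connected := by
    have hr : ∀ x, K.Reachable z x := by
      intro x
      by_cases hx : z = x
      · rw [hx]
      · refine (Adj.reachable ?_)
        exact Or.inr ⟨hx, Or.inl rfl⟩
    exact (connected_iff_exists_forall_reachable K).2 ⟨z, hr⟩
  obtain ⟨F, hFle, hFK, hF⟩ := hK.exists_isTree_le_of_le_of_isAcyclic
    (le_sup_left : G.restrictTo X ≤ K) hac
  -- Edges at `z` point away from it, so no directed path starting elsewhere can use `z`; all other
  -- edges follow the colour.
  let T : Digraph V := ⟨fun a b => F.Adj a b ∧ (a = z ∨ b ≠ z ∧ c a < c b)⟩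
  have hcase : ∀ a b, F.Adj a b → a ≠ z → b ≠ z → (G.restrictTo X).Adj a b := by
    intro a b h ha hb
    rcases hFK h with h | h
    · exact h
    · rcases h.2 with h | h
      · exact absurd h ha
      · exact absurd h hb
  have hT : T.toSimpleGraphInclusive = F := by
    ext a b
    simp only [Digraph.toSimpleGraphInclusive, SimpleGraph.fromRel_adj, T]
    constructor
    · rintro ⟨-, h | h⟩
      · exact h.1
      · exact h.1.symm
    · intro h
      refine ⟨h.ne, ?_⟩
      by_cases ha : a = z
      · exact Or.inl ⟨h, Or.inl ha⟩
      by_cases hb : b = z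
      · exact Or.inr ⟨h.symm, Or.inl hb⟩
      rcases lt_or_gt_of_ne (hc a b (hcase a b h ha hb).1) with hlt | hlt
      · exact Or.inl ⟨h, Or.inr ⟨hb, hlt⟩⟩
      · exact Or.inr ⟨h.symm, Or.inr ⟨ha, hlt⟩⟩
  refine ⟨T, ⟨?_, by rw [hT]; exact hF⟩, ?_⟩
  · rintro a b ⟨hab, h⟩ ⟨hba, h'⟩
    have := hab.ne
    rcases h with rfl | h <;> rcases h' with rfl | h'
    · exact this rfl
    · exact h'.1 rfl
    · exact h.1 rfl
    · omega
  · intro l u hu v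
    constructor
    · rintro ⟨P, -, rfl, rfl, hP⟩
      have huz : P 0 ≠ z := fun h => hz (h ▸ hu)
      have hw := DirWalk.of_fin (r := T.Adj) hP
      clear hu hP
      generalize P 0 = a at hw huz ⊢
      generalize P (Fin.last l) = b at hw ⊢
      clear P
      induction hw with
      | nil u => exact .nil u
      | cons h _ ih =>
        rcases h.2 with h' | h'
        · exact absurd h' huz
        · exact .cons ⟨hcase _ _ h.1 huz h'.1, h'.2⟩ (ih h'.1)
    · intro h
      -- Shifting colours by one and giving the source `z` value 0 makes every arc of `T`
      -- increasing.
      refine DirWalk.exists_injective (c := fun a => if a = z then 0 else c a + 1) (r := T.Adj)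
        ?_ (h.mono fun a b hab => ⟨hFle hab.1, Or.inr ⟨?_, hab.2⟩⟩)
      · rintro a b ⟨hab, h⟩
        have hbz : b ≠ z := by
          rcases h with rfl | h
          · exact hab.ne'
          · exact h.1
        by_cases ha : a = z
        · simp [ha, hbz]
        · have := h.resolve_left ha
          simp [ha, hbz, this.2]
      · rintro rfl
        exact hz hab.1.2.2

theorem isNWillow_of_isIndContained {V : Type} [Finite V] {G : SimpleGraph V} {c : V → ℕ}
    (hc : ∀ u v, G.Adj u v → c u ≠ c v) (hN : ∀ v, c v < N) (hM : (M : ℕ∞) ≤ G.egirth)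
    (hV : M ≤ Nat.card V) {H : FinGraph} (hHG : H.graph ⊴ G.walkGraph c p)
    (hHM : Nat.card H.V + Nat.card H.V * Nat.card H.V * N * N < M) : H.IsNWillow p := by
  classical
  obtain ⟨f⟩ := hHG
  have := H.finiteV
  cases nonempty_fintype H.V
  cases nonempty_fintype V
  -- One vertex set of size at most N witnesses each pair of vertices of H and each length below N;
  -- the bound on M lets all of them fit into a forest.
  have hex : ∀ t : (H.V × H.V) × Fin N, ∃ X : Finset V, X.card ≤ N ∧
      (DirWalk (G.upStep c) t.2 (f t.1.1) (f t.1.2) →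
        DirWalk (fun a b => G.upStep c a b ∧ a ∈ X ∧ b ∈ X) t.2 (f t.1.1) (f t.1.2)) := by
    intro t
    by_cases h : DirWalk (G.upStep c) t.2 (f t.1.1) (f t.1.2)
    · obtain ⟨X, hX, -, hw⟩ := h.exists_finset
      exact ⟨X, hX.trans t.2.2, fun _ => hw⟩
    · exact ⟨∅, by simp, fun h' => absurd h' h⟩
  choose Y hYcard hY using hex
  let X : Finset V := Finset.univ.image f ∪ Finset.univ.biUnion Y
  have hXcard : X.card < M := by
    refine lt_of_le_of_lt ?_ hHM
    refine (Finset.card_union_le _ _).trans (add_le_add ?_ ?_)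
    · rw [Nat.card_eq_fintype_card]
      exact Finset.card_image_le
    · refine (Finset.card_biUnion_le_card_mul _ _ N fun t _ => hYcard t).trans ?_
      simp [Nat.card_eq_fintype_card]
  obtain ⟨z, hz⟩ : ∃ z, z ∉ X := by
    by_contra! hall
    rw [Finset.eq_univ_iff_forall.2 hall, Finset.card_univ, ← Nat.card_eq_fintype_card] at hXcard
    omega
  have hfX : ∀ u, f u ∈ X := fun u => Finset.mem_union_left _ (by simp)
  obtain ⟨T, hT, hpath⟩ := exists_orientedTree (isAcyclic_restrictTo hM hXcard)
    (by simpa using hz) c hc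
  have hiff : ∀ l u v, T.HasDirPath l (f u) (f v) ↔ DirWalk (G.upStep c) l (f u) (f v) := by
    intro l u v
    rw [hpath l (f u) (hfX u)]
    constructor
    · exact DirWalk.mono fun a b h => ⟨h.1.1, h.2⟩
    · intro h
      have hsub : Y ((u, v), ⟨l, dirWalk_upStep_lt hN h⟩) ⊆ X :=
        (Finset.subset_biUnion_of_mem Y (Finset.mem_univ _)).trans Finset.subset_union_right
      exact (hY ((u, v), ⟨l, dirWalk_upStep_lt hN h⟩) h).mono fun a b h =>
        ⟨⟨h.1.1, hsub h.2.1, hsub h.2.2⟩, h.1.2⟩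
  refine ⟨V, inferInstance, T, f.toEmbedding, hT, fun u v huv => ?_⟩
  rw [← f.map_adj_iff]
  constructor
  · rintro ⟨-, l, hl, h⟩
    exact ⟨l, hl, h.imp (hiff l u v).2 (hiff l v u).2⟩
  · rintro ⟨l, hl, h⟩
    exact ⟨fun e => huv (f.injective e), l, hl, h.imp (hiff l u v).1 (hiff l v u).1⟩

end SimpleGraph

/-! ### The class of graphs -/

open SimpleGraph in
theorem mainTheorem4 (F : Set FinGraph) (hfin : F.Finite)
    (hF : ∀ H ∈ F, ¬ H.IsWillow) (q : ℕ) (hq : 0 < q) :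
    ∃ C : Set FinGraph,
      FinGraph.IsHereditary C ∧
      (∀ G ∈ C, FinGraph.IsFree F G) ∧
      ¬ FinGraph.IsChiBounded C ∧
      ∀ G ∈ C, G.graph.cliqueNum < q →
        G.graph.chromaticNumber ≤ (((q + 1).choose 3 : ℕ) : ℕ∞) := by
  obtain ⟨p, hqp, hp⟩ := Nat.exists_infinite_primes q
  have := Fact.mk hp
  -- Quantifying over all induced subgraphs makes the class hereditary by definition.
  refine ⟨{G | G.IsFree F ∧ ∀ H : FinGraph, H.graph ⊴ G.graph → H.graph.cliqueNum ≤ p ∧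
    (H.graph.cliqueNum < q → H.graph.Colorable ((q + 1).choose 3))}, ?_, fun G hG => hG.1, ?_, ?_⟩
  · rintro G ⟨hfree, hG⟩ H hHG
    exact ⟨fun K hK hKH => hfree K hK (hKH.trans hHG), fun K hKH => hG K (hKH.trans hHG)⟩
  · rintro ⟨f, hf⟩
    -- Clique numbers in the class are at most p, so only finitely many values of `f` matter. The
    -- bound k ≥ 2 serves to rule out forests.
    obtain ⟨k, hk2, hkf⟩ : ∃ k, 2 ≤ k ∧ ∀ i ≤ p, f i ≤ k :=
      ⟨(Finset.range (p + 1)).sup f + 2, by omega, fun i hi =>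
        (Finset.le_sup (f := f) (Finset.mem_range_succ_iff.2 hi)).trans (Nat.le_add_right _ 2)⟩
    obtain ⟨h, hFh⟩ : ∃ h, ∀ H ∈ F, Nat.card H.V ≤ h :=
      ⟨hfin.toFinset.sup fun H => Nat.card H.V, fun H hH =>
        Finset.le_sup (f := fun H : FinGraph => Nat.card H.V) (hfin.mem_toFinset.2 hH)⟩
    obtain ⟨N, hNk⟩ : ∃ N, N = k + 1 := ⟨_, rfl⟩
    -- The first two terms pay for the vertices and paths of a member of F, the third for uniqueness
    -- of path lengths.
    obtain ⟨M, hMN⟩ : ∃ M, M = h + h * h * N * N + 2 * N + 1 := ⟨_, rfl⟩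
    obtain ⟨V, hV, G, c, hk, hM, hc, hN⟩ := exists_colouring_of_large_girth (by omega : 0 < k) M
    rw [← hNk] at hN
    -- With fewer than M vertices the graph would be a forest, hence 2-colourable.
    have hcard : M ≤ Nat.card V := by
      by_contra! hlt
      cases nonempty_fintype V
      refine hk ((IsAcyclic.colorable_two ?_).mono hk2)
      have := isAcyclic_restrictTo hM (X := Finset.univ) (by
        rwa [Finset.card_univ, ← Nat.card_eq_fintype_card])
      exact this.anti fun a b hab => (⟨hab, by simp, by simp⟩ : (G.restrictTo _).Adj a b)
    have hfree : FinGraph.IsFree F ⟨V, hV, G.walkGraph c p⟩ := by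
      intro H hH hHG
      refine hF H hH ⟨p, hp.pos, isNWillow_of_isIndContained hc hN hM hcard hHG ?_⟩
      have hle := hFh H hH
      have : Nat.card H.V * Nat.card H.V * N * N ≤ h * h * N * N := by gcongr
      omega
    have hmem : ∀ H : FinGraph, H.graph ⊴ G.walkGraph c p → H.graph.cliqueNum ≤ p ∧
        (H.graph.cliqueNum < q → H.graph.Colorable ((q + 1).choose 3)) := by
      rintro H ⟨e⟩
      have := H.finiteV
      obtain ⟨_, δ, hδ, hH⟩ := exists_cocycle hN hM (by omega) e
      refine ⟨?_, fun hlt => hH.colorable hδ hqp fun C hC =>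
        (IsClique.card_le_cliqueNum (tc := hC)).trans_lt hlt⟩
      obtain ⟨C, hC⟩ := H.graph.exists_isNClique_cliqueNum
      rw [← hC.card_eq]
      exact hH.card_le_of_isClique hδ hC.isClique
    have hχ := hf ⟨V, hV, G.walkGraph c p⟩ ⟨hfree, hmem⟩ Set.univ
    have hω := (hmem ⟨_, Subtype.finite, (G.walkGraph c p).induce Set.univ⟩
      ⟨Embedding.induce _⟩).1
    rw [chromaticNumber_le_iff_colorable] at hχ
    refine hk ((Colorable.mono_left (le_walkGraph hc hp.one_lt.ne')
      (hχ.of_hom (induceUnivIso _).symm.toHom)).mono (hkf _ hω))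
  · rintro G ⟨-, hG⟩ hlt
    exact ((hG G .rfl).2 hlt).chromaticNumber_le
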